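/- Let $(\Omega,\mathcal F,\mathbb P)$ be a probability space and let $\{\emptyset,\Omega\}=\mathcal F_0\subseteq\mathcal F_1\subseteq\mathcal F_2\subseteq\cdots$ be sub-$\sigma$-algebras of $\mathcal F$ with $\mathcal F=\sigma\big(\bigcup_n\mathcal F_n\big)$, each purely atomic, i.e. generated by a countable partition $\mathscr A_n$ of $\Omega$ into sets of positive measure (its atoms); we call $(\Omega,\mathcal F,(\mathcal F_n),\mathbb P)$ a filtered probability space. For every $n\ge 0$ and $A\in\mathscr A_n$ fix an atom $A^*\in\mathscr A_{n+1}$ of maximal measure among the atoms of $\mathcal F_{n+1}$ contained in $A$ (ties may be broken arbitrarily). Let $\mathscr E$ be the collection consisting of $\Omega$ and, for all $n\ge0$ and $A\in\mathscr A_n$, of all $B\in\mathscr A_{n+1}$ with $B\subseteq A$ and $B\ne A^*$, and let $$[\mathscr E]=\sup_{I\in\mathscr E}\frac1{\mathbb P(I)}\sum_{J\in\mathscr E,\;J\subseteq I}\mathbb P(J)$$ be its Carleson constant. For $1<p\le 2$ let $MT_p(\mathbb R)$ be the smallest constant $C$ such that, for every filtered probability space and every real-valued $f\in L^p$, $$\|f\|_{p}\le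 C\Big(|\mathbb E f|^p+\sum_{n=1}^\infty\big\|\mathbb E[f|\mathcal F_n]-\mathbb E[f|\mathcal F_{n-1}]\big\|_{p}^p\Big)^{1/p}.$$ Let $1<p\le2$ and suppose $[\mathscr E]<\infty$. Then the constant $$T_p=\Big(2+\frac1{1-2^{-1/p}}\Big)\,2^{2-\frac1p}\,\big(1+MT_p(\mathbb R)^p\big)^{1/p}\,\big(4[\mathscr E]+1\big)^{1-\frac1p}$$ is finite, and for every Banach space $X$ and every $f\in L^p(\Omega,\mathcal F,\mathbb P;X)$, $$\|f\|_{L^p(\Omega,X)}\le T_p\Big(\|\mathbb E f\|_X^p+\sum_{n=1}^\infty\big\|\mathbb E[f|\mathcal F_n]-\mathbb E[f|\mathcal F_{n-1}]\big\|_{L^p(\Omega,X)}^p\Big)^{1/p}.$$ -/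

import Mathlib

open MeasureTheory
open scoped ENNReal

universe u v

/-- The atoms of a `σ`-algebra `m`: the minimal nonempty `m`-measurable sets. -/
def atomsOf {Ω : Type u} (m : MeasurableSpace Ω) : Set (Set Ω) :=
  {A | MeasurableSet[m] A ∧ A.Nonempty ∧ ∀ B, MeasurableSet[m] B → B ⊆ A → B = ∅ ∨ B = A}

/-- `m` is purely atomic with respect to `μ`: `Ω` is the union of the atoms of `m`, and each atom
has positive measure. For a finite `μ` the atoms then form a countable partition of `Ω`, which
generates `m`. -/
def IsPurelyAtomic {Ω : Type u} {mΩ : MeasurableSpace Ω} (μ : Measure Ω)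
    (m : MeasurableSpace Ω) : Prop :=
  ⋃₀ atomsOf m = Set.univ ∧ ∀ A ∈ atomsOf m, 0 < μ A

/-- `(Ω, 𝓕, (𝓕ₙ), ℙ)` is a filtered probability space (for a probability measure `μ`):
the `𝓕ₙ` increase (part of `Filtration`), are purely atomic and generate the whole `σ`-algebra.
The filtration starts from the trivial `σ`-algebra `𝓕₀ = {∅, Ω}`. -/
structure IsFilteredProbabilitySpace {Ω : Type u} {mΩ : MeasurableSpace Ω} (μ : Measure Ω)
    (ℱ : Filtration ℕ mΩ) : Prop where
  zero_eq : ℱ 0 = ⊥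
  purelyAtomic : ∀ n, IsPurelyAtomic μ (ℱ n)
  iSup_eq : ⨆ n, (ℱ n : MeasurableSpace Ω) = mΩ

/-- `star n A` is a largest atom of `𝓕ₙ₊₁` contained in `A`, for every `n` and every atom `A` of
`𝓕ₙ`. Ties may be broken in any way. -/
def IsLargestChild {Ω : Type u} {mΩ : MeasurableSpace Ω} (μ : Measure Ω)
    (ℱ : Filtration ℕ mΩ) (star : ℕ → Set Ω → Set Ω) : Prop :=
  ∀ n, ∀ A ∈ atomsOf (ℱ n), star n A ∈ atomsOf (ℱ (n + 1)) ∧ star n A ⊆ A ∧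
    ∀ B ∈ atomsOf (ℱ (n + 1)), B ⊆ A → μ B ≤ μ (star n A)

/-- The collection `𝓔` of atoms that are not selected as largest children: it consists of `Ω` and,
for every atom `A` of some `𝓕ₙ`, of all atoms of `𝓕ₙ₊₁` contained in `A` except `star n A`. -/
def unstarredAtoms {Ω : Type u} {mΩ : MeasurableSpace Ω} (ℱ : Filtration ℕ mΩ)
    (star : ℕ → Set Ω → Set Ω) : Set (Set Ω) :=
  {B | B = Set.univ ∨
    ∃ n, ∃ A ∈ atomsOf (ℱ n), B ∈ atomsOf (ℱ (n + 1)) ∧ B ⊆ A ∧ B ≠ star n A}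

/-- The Carleson constant of a collection `R` of sets. -/
noncomputable def carlesonConst {Ω : Type u} {mΩ : MeasurableSpace Ω} (μ : Measure Ω)
    (R : Set (Set Ω)) : ℝ≥0∞ :=
  ⨆ I ∈ R, (μ I)⁻¹ * ∑' J : {J : Set Ω // J ∈ R ∧ J ⊆ I}, μ (J : Set Ω)

/-- `(‖𝔼 f‖ ^ p + ∑_{n ≥ 1} ‖𝔼[f|𝓕ₙ] - 𝔼[f|𝓕ₙ₋₁]‖_p ^ p) ^ (1 / p)`. -/
noncomputable def martingaleDiffNorm {Ω : Type u} {mΩ : MeasurableSpace Ω} {X : Type v}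
    [NormedAddCommGroup X] [NormedSpace ℝ X] [CompleteSpace X] (μ : Measure Ω)
    (ℱ : Filtration ℕ mΩ) (p : ℝ) (f : Ω → X) : ℝ≥0∞ :=
  (‖∫ ω, f ω ∂μ‖ₑ ^ p +
    ∑' n : ℕ, eLpNorm (μ[f|ℱ (n + 1)] - μ[f|ℱ n]) (ENNReal.ofReal p) μ ^ p) ^ (1 / p)

/-- The martingale type `p` constant `MT_p(X)`: the smallest constant in the upper `ℓ^p` estimates,
valid for all filtered probability spaces; it is `∞` if there is no finite one. -/
noncomputable def martingaleTypeConst.{w, z} (p : ℝ) (X : Type z)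
    [NormedAddCommGroup X] [NormedSpace ℝ X] [CompleteSpace X] : ℝ≥0∞ :=
  sInf {C : ℝ≥0∞ | ∀ (Ω : Type w) (mΩ : MeasurableSpace Ω) (μ : Measure Ω)
    (ℱ : Filtration ℕ mΩ), IsProbabilityMeasure μ → IsFilteredProbabilitySpace μ ℱ →
    ∀ f : Ω → X, MemLp f (ENNReal.ofReal p) μ →
      eLpNorm f (ENNReal.ofReal p) μ ≤ C * martingaleDiffNorm μ ℱ p f}

/-- `(2 + 1 / (1 - 2^{-1/p})) 2^{2 - 1/p} (1 + M^p)^{1/p} (4 c + 1)^{1 - 1/p}`. -/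
noncomputable def upperConst (p : ℝ) (M c : ℝ≥0∞) : ℝ≥0∞ :=
  ENNReal.ofReal ((2 + 1 / (1 - (2 : ℝ) ^ (-(1 / p)))) * (2 : ℝ) ^ (2 - 1 / p)) *
    (1 + M ^ p) ^ (1 / p) * (4 * c + 1) ^ (1 - 1 / p)

/-! The estimate already holds for the sum of the norms of the martingale differences `D n = f (n+1)
- f n`, so the geometry of `X` plays no role. On an atom `A` of `ℱ n`, `D n` has mean zero and is
constant on the starred child; hence its mass there is at most its mass on the other children, and
this survives any `ℱ n`-measurable weight. Every integral of `‖D n‖` against the past therefore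
costs at most twice its part over the union `U n` of the unstarred children.

Let `H n` be the partial sums of the norms, starting with `‖𝔼 f‖`. Expanding `H (n+1) ^ p` leaves a
cross term `‖D n‖ * H n ^ (p-1)`. It is moved to `U n` and split by Young's inequality with weight
`L = 4 [𝓔] + 1`; since `H ^ p` is increasing and adapted, Carleson embedding bounds the sum of `∫_{U
n} H n ^ p` by `[𝓔] ∫ H N ^ p`. The choice of `L` makes this at most half of the left side, which is
absorbed (`lintegral_sum_rpow_le`), leaving the factor `8 * L ^ (p-1)`. Lévy's theorem and Fatou
pass from `𝔼[f|ℱ N]` to `f`.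

The constant `MT_p(ℝ)` enters the norm bound only through a factor at least `1`. Its finiteness,
needed for `T_p < ∞`, has a separate elementary proof. -/

section Atoms

/-! ### Atoms of a purely atomic σ-algebra. -/

variable {Ω : Type u} {m mΩ : MeasurableSpace Ω} {μ : Measure Ω}

theorem subset_or_disjoint_of_mem_atomsOf {A S : Set Ω} (hA : A ∈ atomsOf m)
    (hS : MeasurableSet[m] S) : A ⊆ S ∨ Disjoint A S := by
  rcases hA.2.2 (A ∩ S) (hA.1.inter hS) Set.inter_subset_left with h | h
  · exact Or.inr (Set.disjoint_iff_inter_eq_empty.2 h)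
  · exact Or.inl (Set.inter_eq_left.1 h)

theorem pairwiseDisjoint_atomsOf (m : MeasurableSpace Ω) : (atomsOf m).PairwiseDisjoint id := by
  intro A hA B hB hAB
  rcases subset_or_disjoint_of_mem_atomsOf hA hB.1 with h | h
  · rcases hB.2.2 A hA.1 h with h | h
    · exact absurd h hA.2.1.ne_empty
    · exact absurd h hAB
  · exact h

theorem eq_of_mem_atomsOf {A B : Set Ω} (hA : A ∈ atomsOf m) (hB : B ∈ atomsOf m) {x : Ω}
    (hxA : x ∈ A) (hxB : x ∈ B) : A = B := by
  by_contra h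
  exact Set.disjoint_left.1 (pairwiseDisjoint_atomsOf m hA hB h) hxA hxB

theorem IsPurelyAtomic.exists_mem (h : IsPurelyAtomic μ m) (x : Ω) : ∃ A ∈ atomsOf m, x ∈ A := by
  simpa [Set.mem_sUnion] using h.1.symm.subset (Set.mem_univ x)

theorem IsPurelyAtomic.countable_atomsOf [IsFiniteMeasure μ] (h : IsPurelyAtomic μ m)
    (hm : m ≤ mΩ) : (atomsOf m).Countable := by
  have key := Measure.countable_meas_pos_of_disjoint_iUnion (μ := μ)
    (As := fun A : atomsOf m => (A : Set Ω)) (fun A => hm _ A.2.1)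
    (fun A B hAB => pairwiseDisjoint_atomsOf m A.2 B.2 (fun h => hAB (Subtype.ext h)))
  have : {i : atomsOf m | 0 < μ (i : Set Ω)} = Set.univ :=
    Set.eq_univ_of_forall fun A => h.2 A A.2
  rw [this] at key
  exact Set.countable_coe_iff.1 (Set.countable_univ_iff.1 key)

theorem measurableSet_sUnion_atomsOf [IsFiniteMeasure μ] (h : IsPurelyAtomic μ m)
    (hm : m ≤ mΩ) {S : Set (Set Ω)} (hS : S ⊆ atomsOf m) : MeasurableSet[m] (⋃₀ S) :=
  MeasurableSet.sUnion ((h.countable_atomsOf hm).mono hS) fun _ hA => (hS hA).1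

theorem lintegral_inter_eq_tsum_atomsOf [IsFiniteMeasure μ] (h : IsPurelyAtomic μ m)
    (hm : m ≤ mΩ) {S : Set Ω} (hS : MeasurableSet S) (g : Ω → ℝ≥0∞) :
    ∫⁻ x in S, g x ∂μ = ∑' A : atomsOf m, ∫⁻ x in S ∩ A, g x ∂μ := by
  have : S = ⋃ A ∈ atomsOf m, S ∩ A := by
    rw [← Set.inter_iUnion₂, ← Set.sUnion_eq_biUnion, h.1, Set.inter_univ]
  conv_lhs => rw [this]
  refine lintegral_biUnion (h.countable_atomsOf hm) (fun A hA => hS.inter (hm _ hA.1)) ?_ _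
  intro A hA B hB hAB
  exact (pairwiseDisjoint_atomsOf m hA hB hAB).mono Set.inter_subset_right Set.inter_subset_right

/-- A level set of `f` is `m`-measurable, so it cannot split an atom. -/
theorem apply_eq_of_mem_atomsOf {E : Type*} [TopologicalSpace E]
    [TopologicalSpace.MetrizableSpace E] {f : Ω → E} (hf : StronglyMeasurable[m] f) {A : Set Ω}
    (hA : A ∈ atomsOf m) {x y : Ω} (hx : x ∈ A) (hy : y ∈ A) : f y = f x := by
  have hS : MeasurableSet[m] {z | f z = f x} :=
    hf.measurableSet_eq_fun stronglyMeasurable_const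
  rcases subset_or_disjoint_of_mem_atomsOf hA hS with h | h
  · exact h hy
  · exact absurd rfl (Set.disjoint_left.1 h hx)

end Atoms

/-! ### Unstarred atoms and the Carleson condition on sets. -/

section Unstarred

variable {Ω : Type u} {mΩ : MeasurableSpace Ω} {μ : Measure Ω} {ℱ : Filtration ℕ mΩ}
  {star : ℕ → Set Ω → Set Ω}

/-- The atoms of `ℱ (n + 1)` that are not the selected largest child of an atom of `ℱ n`. -/
def unstarredChildren (ℱ : Filtration ℕ mΩ) (star : ℕ → Set Ω → Set Ω) (n : ℕ) : Set (Set Ω) :=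
  {B | B ∈ atomsOf (ℱ (n + 1)) ∧ ∃ A ∈ atomsOf (ℱ n), B ⊆ A ∧ B ≠ star n A}

/-- The union of the unstarred atoms of `ℱ (n + 1)`. -/
def unstarredSet (ℱ : Filtration ℕ mΩ) (star : ℕ → Set Ω → Set Ω) (n : ℕ) : Set Ω :=
  ⋃₀ unstarredChildren ℱ star n

theorem unstarredChildren_subset_atomsOf (n : ℕ) :
    unstarredChildren ℱ star n ⊆ atomsOf (ℱ (n + 1)) := fun _ hB => hB.1

theorem unstarredChildren_subset_unstarredAtoms (n : ℕ) :
    unstarredChildren ℱ star n ⊆ unstarredAtoms ℱ star :=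
  fun _ ⟨hB, A, hA, h⟩ => Or.inr ⟨n, A, hA, hB, h⟩

theorem measurableSet_unstarredSet [IsFiniteMeasure μ] (hℱ : IsFilteredProbabilitySpace μ ℱ)
    (n : ℕ) : MeasurableSet[ℱ (n + 1)] (unstarredSet ℱ star n) :=
  measurableSet_sUnion_atomsOf (hℱ.purelyAtomic _) (ℱ.le _) (unstarredChildren_subset_atomsOf n)

theorem subset_of_mem_atomsOf_of_le
    {i j : ℕ} (hij : i ≤ j) {A B : Set Ω} (hA : A ∈ atomsOf (ℱ i)) (hB : B ∈ atomsOf (ℱ j)) {x : Ω}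
    (hxA : x ∈ A) (hxB : x ∈ B) : B ⊆ A := by
  rcases subset_or_disjoint_of_mem_atomsOf hB (ℱ.mono hij _ hA.1) with h | h
  · exact h
  · exact absurd hxA (Set.disjoint_left.1 h hxB)

/-- The part of an atom outside of the unstarred set is its selected largest child. -/
theorem diff_unstarredSet (hℱ : IsFilteredProbabilitySpace μ ℱ) (hstar : IsLargestChild μ ℱ star)
    {n : ℕ} {A : Set Ω} (hA : A ∈ atomsOf (ℱ n)) : A \ unstarredSet ℱ star n = star n A := by
  obtain ⟨hs, hsA, -⟩ := hstar n A hA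
  ext x
  constructor
  · rintro ⟨hxA, hxU⟩
    obtain ⟨B, hB, hxB⟩ := (hℱ.purelyAtomic (n + 1)).exists_mem x
    by_contra hx
    refine hxU ⟨B, ⟨hB, A, hA, subset_of_mem_atomsOf_of_le n.le_succ hA hB hxA hxB, ?_⟩, hxB⟩
    rintro rfl
    exact hx hxB
  · intro hx
    refine ⟨hsA hx, ?_⟩
    rintro ⟨B, ⟨hB, A', hA', hBA', hne⟩, hxB⟩
    obtain rfl : A = A' := eq_of_mem_atomsOf hA hA' (hsA hx) (hBA' hxB)
    exact hne (eq_of_mem_atomsOf hB hs hxB hx)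

/-- A set is an unstarred child at one level at most. -/
theorem eq_of_mem_unstarredChildren (hstar : IsLargestChild μ ℱ star) {i j : ℕ} {B : Set Ω}
    (hi : B ∈ unstarredChildren ℱ star i) (hj : B ∈ unstarredChildren ℱ star j) : i = j := by
  have key : ∀ {i j : ℕ}, B ∈ unstarredChildren ℱ star i → B ∈ unstarredChildren ℱ star j →
      ¬ i < j := by
    rintro i j ⟨hBi, -⟩ ⟨hBj, A, hA, hBA, hne⟩ hij
    obtain ⟨x, hx⟩ := hBi.2.1
    -- As `i + 1 ≤ j`, the parent `A` at level `j` lies in the older atom `B`. So `B` did not split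
    -- there, and the starred child of `A` can only be `B`.
    have hAB : A ⊆ B := subset_of_mem_atomsOf_of_le hij hBi hA hx (hBA hx)
    obtain ⟨hs, hsA, -⟩ := hstar j A hA
    obtain ⟨y, hy⟩ := hs.2.1
    exact hne (eq_of_mem_atomsOf hBj hs (hAB (hsA hy)) hy)
  exact le_antisymm (not_lt.1 (key hj hi)) (not_lt.1 (key hi hj))

theorem measure_unstarredSet_inter [IsFiniteMeasure μ] (hℱ : IsFilteredProbabilitySpace μ ℱ)
    {n k : ℕ} (hkn : k ≤ n + 1) {A : Set Ω} (hA : A ∈ atomsOf (ℱ k)) :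
    μ (unstarredSet ℱ star n ∩ A) =
      ∑' B : {B : Set Ω // B ∈ unstarredChildren ℱ star n ∧ B ⊆ A}, μ (B : Set Ω) := by
  have : unstarredSet ℱ star n ∩ A = ⋃₀ {B | B ∈ unstarredChildren ℱ star n ∧ B ⊆ A} := by
    ext x
    constructor
    · rintro ⟨⟨B, hB, hxB⟩, hxA⟩
      exact ⟨B, ⟨hB, subset_of_mem_atomsOf_of_le hkn hA hB.1 hxA hxB⟩, hxB⟩
    · rintro ⟨B, ⟨hB, hBA⟩, hxB⟩
      exact ⟨⟨B, hB, hxB⟩, hBA hxB⟩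
  have hsub : {B | B ∈ unstarredChildren ℱ star n ∧ B ⊆ A} ⊆ atomsOf (ℱ (n + 1)) :=
    fun B hB => hB.1.1
  rw [this, measure_sUnion (((hℱ.purelyAtomic _).countable_atomsOf (ℱ.le _)).mono hsub)
    ((pairwiseDisjoint_atomsOf _).subset hsub) (fun B hB => ℱ.le _ _ (hsub hB).1)]
  rfl

theorem add_tsum_comp_le_tsum {α β : Type*} (g : β → ℝ≥0∞) {F : α → β}
    (hF : Function.Injective F) {b : β} (hb : b ∉ Set.range F) :
    g b + ∑' a, g (F a) ≤ ∑' x, g x := by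
  have hinj : Function.Injective (Sum.elim (fun _ : Unit => b) F) :=
    (Function.injective_of_subsingleton _).sumElim hF fun _ a h => hb ⟨a, h.symm⟩
  refine le_trans (le_of_eq ?_) (ENNReal.tsum_comp_le_tsum_of_injective hinj g)
  rw [Summable.tsum_sum ENNReal.summable ENNReal.summable]
  simp

/-- The Carleson condition at an unstarred atom, in terms of the unstarred sets. -/
theorem measure_add_sum_unstarredSet_le [IsFiniteMeasure μ] (hℱ : IsFilteredProbabilitySpace μ ℱ)
    (hstar : IsLargestChild μ ℱ star) {k : ℕ} (N : ℕ) {B : Set Ω}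
    (hB : B ∈ unstarredChildren ℱ star k) :
    μ B + ∑ n ∈ Finset.Ico (k + 1) N, μ (unstarredSet ℱ star n ∩ B) ≤
      carlesonConst μ (unstarredAtoms ℱ star) * μ B := by
  have hpos : μ B ≠ 0 := ((hℱ.purelyAtomic _).2 B hB.1).ne'
  have hle : (μ B)⁻¹ * ∑' J : {J : Set Ω // J ∈ unstarredAtoms ℱ star ∧ J ⊆ B}, μ (J : Set Ω) ≤
      carlesonConst μ (unstarredAtoms ℱ star) :=
    le_iSup₂ (f := fun I (_ : I ∈ unstarredAtoms ℱ star) => (μ I)⁻¹ *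
      ∑' J : {J : Set Ω // J ∈ unstarredAtoms ℱ star ∧ J ⊆ I}, μ (J : Set Ω)) B
      (unstarredChildren_subset_unstarredAtoms k hB)
  have hsum : ∑' J : {J : Set Ω // J ∈ unstarredAtoms ℱ star ∧ J ⊆ B}, μ (J : Set Ω) ≤
      carlesonConst μ (unstarredAtoms ℱ star) * μ B := by
    rw [mul_comm] at hle
    rw [← ENNReal.div_eq_inv_mul.trans (mul_comm _ _)] at hle
    exact (ENNReal.div_le_iff hpos (measure_ne_top _ _)).1 hle
  refine le_trans ?_ hsum
  -- An unstarred set determines its level, so no set is counted twice; `B` itself has level `k`,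
  -- outside the range, and supplies the extra summand `μ B`.
  have hF : Function.Injective fun q : (Σ n : Finset.Ico (k + 1) N,
      {J : Set Ω // J ∈ unstarredChildren ℱ star n ∧ J ⊆ B}) =>
      (⟨q.2.1, unstarredChildren_subset_unstarredAtoms _ q.2.2.1, q.2.2.2⟩ :
        {J : Set Ω // J ∈ unstarredAtoms ℱ star ∧ J ⊆ B}) := by
    rintro ⟨⟨n, hn⟩, J, hJ⟩ ⟨⟨n', hn'⟩, J', hJ'⟩ h
    obtain rfl : J = J' := congrArg Subtype.val h
    obtain rfl : n = n' := eq_of_mem_unstarredChildren hstar hJ.1 hJ'.1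
    rfl
  refine le_trans (le_of_eq ?_) (add_tsum_comp_le_tsum
    (fun J : {J : Set Ω // J ∈ unstarredAtoms ℱ star ∧ J ⊆ B} => μ (J : Set Ω)) hF
    (b := ⟨B, unstarredChildren_subset_unstarredAtoms k hB, subset_rfl⟩) ?_)
  · refine congrArg (μ B + ·) ?_
    refine Eq.trans ?_ (ENNReal.tsum_sigma fun (n : Finset.Ico (k + 1) N)
      (J : {J : Set Ω // J ∈ unstarredChildren ℱ star n ∧ J ⊆ B}) => μ (J : Set Ω)).symm
    rw [tsum_fintype, ← Finset.sum_coe_sort]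
    refine Finset.sum_congr rfl fun n _ => ?_
    exact measure_unstarredSet_inter hℱ (by have := (Finset.mem_Ico.1 n.2).1; omega) hB.1
  · rintro ⟨⟨⟨n, hn⟩, J, hJ, hJB⟩, h⟩
    have hJ' : J ∈ unstarredChildren ℱ star n := hJ
    rw [show J = B from congrArg Subtype.val h] at hJ'
    have := eq_of_mem_unstarredChildren hstar hB hJ'
    rw [Finset.mem_Ico] at hn
    omega

/-- The Carleson condition for the whole filtration: it holds for each set of each `ℱ k`. -/
theorem sum_measure_unstarredSet_inter_le [IsFiniteMeasure μ]
    (hℱ : IsFilteredProbabilitySpace μ ℱ) (hstar : IsLargestChild μ ℱ star) (k N : ℕ)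
    {A : Set Ω} (hA : MeasurableSet[ℱ k] A) :
    ∑ n ∈ Finset.Ico k N, μ (unstarredSet ℱ star n ∩ A) ≤
      carlesonConst μ (unstarredAtoms ℱ star) * μ A := by
  rcases le_or_gt N k with hNk | hNk
  · simp [Finset.Ico_eq_empty_of_le hNk]
  induction h : N - k generalizing k A with
  | zero => omega
  | succ r ih =>
    set c := carlesonConst μ (unstarredAtoms ℱ star) with hc
    set U := unstarredSet ℱ star k with hU
    have hUm : MeasurableSet[ℱ (k + 1)] U := measurableSet_unstarredSet hℱ k
    have hAm : MeasurableSet[ℱ (k + 1)] A := ℱ.mono k.le_succ _ hA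
    -- Level `k` charges nothing on `A \ U`, and this set belongs to `ℱ (k + 1)`: the induction
    -- hypothesis applies.
    have hdiff : ∑ n ∈ Finset.Ico (k + 1) N, μ (unstarredSet ℱ star n ∩ (A \ U)) ≤
        c * μ (A \ U) := by
      rcases le_or_gt N (k + 1) with h | h
      · simp [Finset.Ico_eq_empty_of_le h]
      · exact ih (k + 1) (hAm.diff hUm) h (by omega)
    have hdecomp : ∀ S : Set Ω, MeasurableSet S → μ (S ∩ (A ∩ U)) =
        ∑' B : unstarredChildren ℱ star k, μ (S ∩ A ∩ B) := by
      intro S hS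
      rw [← Set.inter_assoc, hU, unstarredSet, Set.sUnion_eq_biUnion, Set.inter_iUnion₂,
        measure_biUnion (((hℱ.purelyAtomic _).countable_atomsOf (ℱ.le _)).mono
          (unstarredChildren_subset_atomsOf k))]
      · intro B hB B' hB' hne
        exact (pairwiseDisjoint_atomsOf _ hB.1 hB'.1 hne).mono Set.inter_subset_right
          Set.inter_subset_right
      · exact fun B hB => (hS.inter (ℱ.le _ _ hAm)).inter (ℱ.le _ _ hB.1.1)
    -- `A ∩ U` is a disjoint union of unstarred atoms, each covered by the Carleson condition at
    -- that atom. The first summand is the contribution of level `k`.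
    have hint : μ (A ∩ U) + ∑ n ∈ Finset.Ico (k + 1) N, μ (unstarredSet ℱ star n ∩ (A ∩ U)) ≤
        c * μ (A ∩ U) := by
      have h0 := hdecomp Set.univ MeasurableSet.univ
      simp only [Set.univ_inter] at h0
      rw [Finset.sum_congr rfl fun n _ => hdecomp _ (ℱ.le _ _ (measurableSet_unstarredSet hℱ n)),
        h0, ← ENNReal.tsum_mul_left,
        ← Summable.tsum_finsetSum fun _ _ => ENNReal.summable, ← ENNReal.tsum_add]
      refine ENNReal.tsum_le_tsum fun B => ?_
      rcases subset_or_disjoint_of_mem_atomsOf B.2.1 hAm with h | h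
      · simp only [Set.inter_assoc, Set.inter_eq_right.2 h]
        exact measure_add_sum_unstarredSet_le hℱ hstar N B.2
      · simp [Set.inter_assoc, Set.disjoint_iff_inter_eq_empty.1 h.symm]
    rw [Finset.sum_eq_sum_Ico_succ_bot hNk, ← measure_inter_add_sdiff A (ℱ.le _ _ hUm), mul_add,
      Set.inter_comm]
    have hsplit : ∀ n, μ (unstarredSet ℱ star n ∩ A) = μ (unstarredSet ℱ star n ∩ (A ∩ U)) +
        μ (unstarredSet ℱ star n ∩ (A \ U)) := by
      intro n
      rw [← Set.inter_assoc, ← Set.inter_sdiff_assoc, measure_inter_add_sdiff _ (ℱ.le _ _ hUm)]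
    rw [Finset.sum_congr rfl fun n _ => hsplit n, Finset.sum_add_distrib, ← add_assoc]
    exact add_le_add hint hdiff

end Unstarred

/-! ### Young's inequality and the expansion of a `p`-th power. -/

section Inequalities

theorem young_rpow_sub_one {p : ℝ} (hp : 1 < p) {a b : ℝ} (ha : 0 ≤ a) (hb : 0 ≤ b) :
    p * (a * b ^ (p - 1)) ≤ a ^ p + (p - 1) * b ^ p := by
  have hpq : p.HolderConjugate (Real.conjExponent p) := Real.HolderConjugate.conjExponent hp
  have h := Real.young_inequality_of_nonneg ha (Real.rpow_nonneg hb (p - 1)) hpq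
  have hp0 : 0 < p := by linarith
  have hp1 : 0 < p - 1 := by linarith
  have hq : (b ^ (p - 1)) ^ (Real.conjExponent p) = b ^ p := by
    rw [← Real.rpow_mul hb, Real.conjExponent, mul_div_cancel₀ _ hp1.ne']
  rw [hq, Real.conjExponent] at h
  calc p * (a * b ^ (p - 1)) ≤ p * (a ^ p / p + b ^ p / (p / (p - 1))) :=
        mul_le_mul_of_nonneg_left h hp0.le
    _ = a ^ p + (p - 1) * b ^ p := by field_simp

theorem self_mul_rpow_sub_one {p : ℝ} (hp : 1 < p) {x : ℝ} (hx : 0 ≤ x) :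
    x * x ^ (p - 1) = x ^ p := by
  rcases hx.eq_or_lt with rfl | h
  · rw [Real.zero_rpow (by linarith : p ≠ 0), zero_mul]
  · nth_rewrite 1 [← Real.rpow_one x]
    rw [← Real.rpow_add h]
    ring_nf

/-- Young for `s * (s + a) ^ (p - 1)` gives the convexity bound `(s + a) ^ p ≤ s ^ p + p * a * (s +
a) ^ (p - 1)`; then `t ^ (p - 1)` is subadditive because `p ≤ 2`. -/
theorem add_rpow_le_add_mul {p : ℝ} (hp1 : 1 < p) (hp2 : p ≤ 2) {a s : ℝ} (ha : 0 ≤ a)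
    (hs : 0 ≤ s) : (s + a) ^ p ≤ s ^ p + p * (a * s ^ (p - 1)) + p * a ^ p := by
  have h1 := young_rpow_sub_one hp1 hs (add_nonneg hs ha)
  have h2 := self_mul_rpow_sub_one hp1 (add_nonneg hs ha)
  have h3 := self_mul_rpow_sub_one hp1 ha
  have h4 : (s + a) ^ (p - 1) ≤ s ^ (p - 1) + a ^ (p - 1) :=
    Real.rpow_add_le_add_rpow hs ha (by linarith) (by linarith)
  have h5 : p * (a * (s + a) ^ (p - 1)) ≤ p * (a * (s ^ (p - 1) + a ^ (p - 1))) := by gcongr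
  nlinarith

theorem ENNReal.add_rpow_le_add_mul {p : ℝ} (hp1 : 1 < p) (hp2 : p ≤ 2) (s a : ℝ≥0∞) :
    (s + a) ^ p ≤ s ^ p + ENNReal.ofReal p * (a * s ^ (p - 1)) + ENNReal.ofReal p * a ^ p := by
  have hp0 : 0 < p := by linarith
  induction s with
  | top => simp [ENNReal.top_rpow_of_pos hp0]
  | coe s =>
  induction a with
  | top => simp [ENNReal.top_rpow_of_pos hp0, ENNReal.mul_top, hp0]
  | coe a =>
  have h := _root_.add_rpow_le_add_mul hp1 hp2 a.2 s.2
  rw [ENNReal.ofReal, ← ENNReal.coe_add, ← ENNReal.coe_rpow_of_nonneg _ hp0.le,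
    ← ENNReal.coe_rpow_of_nonneg _ hp0.le, ← ENNReal.coe_rpow_of_nonneg _ hp0.le,
    ← ENNReal.coe_rpow_of_nonneg _ (by linarith : 0 ≤ p - 1)]
  norm_cast
  rw [← NNReal.coe_le_coe]
  push_cast
  rw [Real.coe_toNNReal _ hp0.le]
  exact h

/-- Young's inequality for `a * s ^ (p - 1)`, weighted by `L`. -/
theorem ENNReal.mul_rpow_sub_one_le {p : ℝ} (hp1 : 1 < p) (hp2 : p ≤ 2) {L : ℝ≥0∞} (hL0 : L ≠ 0)
    (hL : L ≠ ∞) (s a : ℝ≥0∞) :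
    ENNReal.ofReal p * (a * s ^ (p - 1)) ≤ L ^ (p - 1) * a ^ p + L⁻¹ * s ^ p := by
  have hp0 : 0 < p := by linarith
  have hp10 : 0 < p - 1 := by linarith
  induction s with
  | top => simp [ENNReal.top_rpow_of_pos hp0, ENNReal.mul_top, hL]
  | coe s =>
  induction a with
  | top => simp [ENNReal.top_rpow_of_pos hp0, ENNReal.mul_top, hL0, hL]
  | coe a =>
  lift L to NNReal using hL
  have hL0' : L ≠ 0 := by simpa using hL0
  have hLpos : (0 : ℝ) < L := by exact_mod_cast pos_iff_ne_zero.2 hL0'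
  -- The two powers of `L` cancel in `a * s ^ (p - 1)` and become `L ^ (p - 1)` and `L⁻¹` on the
  -- right. Young's factor `p - 1 ≤ 1` is dropped at the end.
  have h := young_rpow_sub_one hp1 (a := (L : ℝ) ^ ((p - 1) / p) * a) (b := (L : ℝ) ^ (-(1 / p)) * s)
    (by positivity) (by positivity)
  rw [Real.mul_rpow (by positivity) (by positivity), Real.mul_rpow (by positivity) (by positivity),
    Real.mul_rpow (by positivity) (by positivity), ← Real.rpow_mul hLpos.le,
    ← Real.rpow_mul hLpos.le, ← Real.rpow_mul hLpos.le, div_mul_cancel₀ _ hp0.ne', neg_mul, neg_mul,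
    div_mul_cancel₀ _ hp0.ne', Real.rpow_neg_one] at h
  have hmul : (L : ℝ) ^ ((p - 1) / p) * (L : ℝ) ^ (-(1 / p * (p - 1))) = 1 := by
    rw [← Real.rpow_add hLpos]
    convert Real.rpow_zero (L : ℝ) using 2
    ring
  have hfin : p * ((a : ℝ) * (s : ℝ) ^ (p - 1)) ≤
      (L : ℝ) ^ (p - 1) * (a : ℝ) ^ p + (L : ℝ)⁻¹ * (s : ℝ) ^ p := by
    calc p * ((a : ℝ) * (s : ℝ) ^ (p - 1))
        = p * ((L : ℝ) ^ ((p - 1) / p) * a *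
            ((L : ℝ) ^ (-(1 / p * (p - 1))) * (s : ℝ) ^ (p - 1))) := by
          linear_combination (-(p * ((a : ℝ) * (s : ℝ) ^ (p - 1)))) * hmul
      _ ≤ _ := h
      _ ≤ _ := by
          have : 0 ≤ (L : ℝ)⁻¹ * (s : ℝ) ^ p := by positivity
          nlinarith
  rw [ENNReal.ofReal, ← ENNReal.coe_inv hL0', ← ENNReal.coe_rpow_of_nonneg _ hp0.le,
    ← ENNReal.coe_rpow_of_nonneg _ hp0.le, ← ENNReal.coe_rpow_of_nonneg _ hp10.le,
    ← ENNReal.coe_rpow_of_nonneg _ hp10.le]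
  norm_cast
  rw [← NNReal.coe_le_coe]
  push_cast
  rw [Real.coe_toNNReal _ hp0.le]
  exact hfin

end Inequalities

/-! ### Carleson embedding. -/

section Carleson

variable {Ω : Type u} {mΩ : MeasurableSpace Ω} {μ : Measure Ω} {ℱ : Filtration ℕ mΩ}
  {star : ℕ → Set Ω → Set Ω}

/-- An `m`-measurable integrand sees only the restrictions of the measures to `m`. This turns
inequalities on sets into weighted ones. -/
theorem lintegral_le_lintegral_of_forall_measurableSet {Ω : Type*} {m mΩ : MeasurableSpace Ω}
    (hm : m ≤ mΩ)
    {μ₁ μ₂ : Measure Ω} (h : ∀ A, MeasurableSet[m] A → μ₁ A ≤ μ₂ A) {g : Ω → ℝ≥0∞}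
    (hg : Measurable[m] g) : ∫⁻ x, g x ∂μ₁ ≤ ∫⁻ x, g x ∂μ₂ := by
  rw [← lintegral_trim hm hg, ← lintegral_trim hm hg]
  refine lintegral_mono' (Measure.le_iff.2 fun A hA => ?_) le_rfl
  rw [trim_measurableSet_eq hm hA, trim_measurableSet_eq hm hA]
  exact h A hA

theorem sum_setLIntegral_unstarredSet_le [IsFiniteMeasure μ]
    (hℱ : IsFilteredProbabilitySpace μ ℱ) (hstar : IsLargestChild μ ℱ star) (k N : ℕ)
    {g : Ω → ℝ≥0∞} (hg : Measurable[ℱ k] g) :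
    ∑ n ∈ Finset.Ico k N, ∫⁻ x in unstarredSet ℱ star n, g x ∂μ ≤
      carlesonConst μ (unstarredAtoms ℱ star) * ∫⁻ x, g x ∂μ := by
  rw [← lintegral_finsetSum_measure, ← smul_eq_mul, ← lintegral_smul_measure]
  refine lintegral_le_lintegral_of_forall_measurableSet (ℱ.le k) (fun A hA => ?_) hg
  simp only [Measure.coe_finsetSum, Finset.sum_apply, Measure.smul_apply, smul_eq_mul,
    Measure.restrict_apply (ℱ.le _ _ hA)]
  simp only [Set.inter_comm A]
  exact sum_measure_unstarredSet_inter_le hℱ hstar k N hA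

/-- **Carleson embedding** for increasing adapted processes. -/
theorem sum_setLIntegral_unstarredSet_le_of_monotone [IsFiniteMeasure μ]
    (hℱ : IsFilteredProbabilitySpace μ ℱ) (hstar : IsLargestChild μ ℱ star) (N : ℕ)
    {h : ℕ → Ω → ℝ≥0∞} (hm : ∀ n, Measurable[ℱ n] (h n)) (hmono : Monotone h) :
    ∑ n ∈ Finset.range N, ∫⁻ x in unstarredSet ℱ star n, h n x ∂μ ≤
      carlesonConst μ (unstarredAtoms ℱ star) * ∫⁻ x, h N x ∂μ := by
  -- Summation by parts: the increment `g k` is `ℱ k`-measurable and occurs only at levels `n ≥ k`,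
  -- where the estimate for a fixed weight applies.
  let g : ℕ → Ω → ℝ≥0∞ := fun n => Nat.casesOn n (h 0) fun k x => h (k + 1) x - h k x
  have hgm : ∀ n, Measurable[ℱ n] (g n) := by
    rintro (_ | n)
    · exact hm 0
    · exact (hm (n + 1)).sub ((hm n).mono (ℱ.mono n.le_succ) le_rfl)
  have hsum : ∀ n x, h n x = ∑ k ∈ Finset.range (n + 1), g k x := by
    intro n x
    induction n with
    | zero => simp [g]
    | succ n ih =>
      rw [Finset.sum_range_succ, ← ih]
      exact (add_tsub_cancel_of_le (hmono n.le_succ x)).symm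
  have hgm' : ∀ n, Measurable (g n) := fun n => (hgm n).mono (ℱ.le n) le_rfl
  calc ∑ n ∈ Finset.range N, ∫⁻ x in unstarredSet ℱ star n, h n x ∂μ
      = ∑ n ∈ Finset.range N, ∑ k ∈ Finset.range (n + 1),
          ∫⁻ x in unstarredSet ℱ star n, g k x ∂μ := by
        refine Finset.sum_congr rfl fun n _ => ?_
        simp_rw [hsum n]
        exact lintegral_finsetSum _ fun k _ => hgm' k
    _ = ∑ k ∈ Finset.range N, ∑ n ∈ Finset.Ico k N,
          ∫⁻ x in unstarredSet ℱ star n, g k x ∂μ := by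
        refine Finset.sum_comm' fun n k => ?_
        simp only [Finset.mem_range, Finset.mem_Ico]
        omega
    _ ≤ ∑ k ∈ Finset.range N, carlesonConst μ (unstarredAtoms ℱ star) * ∫⁻ x, g k x ∂μ :=
        Finset.sum_le_sum fun k _ => sum_setLIntegral_unstarredSet_le hℱ hstar k N (hgm k)
    _ = carlesonConst μ (unstarredAtoms ℱ star) *
          ∫⁻ x, ∑ k ∈ Finset.range N, g k x ∂μ := by
        rw [← Finset.mul_sum, lintegral_finsetSum _ fun k _ => hgm' k]
    _ ≤ _ := by
        gcongr with x
        rw [hsum N x]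
        exact Finset.sum_le_sum_of_subset (Finset.range_mono N.le_succ)

end Carleson

/-! ### Mean zero moves mass off the starred child. -/

section MeanZero

variable {Ω : Type u} {mΩ : MeasurableSpace Ω} {μ : Measure Ω} {ℱ : Filtration ℕ mΩ}
  {star : ℕ → Set Ω → Set Ω} {X : Type v} [NormedAddCommGroup X] [NormedSpace ℝ X]

/-- If `D` is `ℱ (n + 1)`-measurable and has mean zero on an atom `A` of `ℱ n`, then its mass on the
largest child of `A` is controlled by its mass on the other children. -/
theorem setLIntegral_enorm_diff_le [IsFiniteMeasure μ] [CompleteSpace X]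
    (hℱ : IsFilteredProbabilitySpace μ ℱ)
    (hstar : IsLargestChild μ ℱ star) {n : ℕ} {D : Ω → X} (hD : StronglyMeasurable[ℱ (n + 1)] D)
    (hint : Integrable D μ) {A : Set Ω} (hA : A ∈ atomsOf (ℱ n)) (h0 : ∫ x in A, D x ∂μ = 0) :
    ∫⁻ x in A \ unstarredSet ℱ star n, ‖D x‖ₑ ∂μ ≤
      ∫⁻ x in A ∩ unstarredSet ℱ star n, ‖D x‖ₑ ∂μ := by
  have hU : MeasurableSet (unstarredSet ℱ star n) :=
    ℱ.le _ _ (measurableSet_unstarredSet hℱ n)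
  have hsplit := setIntegral_union (μ := μ) (f := D) (s := A ∩ unstarredSet ℱ star n)
    (t := A \ unstarredSet ℱ star n) Set.disjoint_sdiff_inter.symm ((ℱ.le _ _ hA.1).diff hU)
    hint.integrableOn hint.integrableOn
  rw [Set.inter_union_sdiff, h0] at hsplit
  have hs := (hstar n A hA).1
  obtain ⟨x₀, hx₀⟩ := hs.2.1
  have hsm : MeasurableSet (star n A) := ℱ.le _ _ hs.1
  -- Constancy on the starred child makes the integral of the norm there the norm of the integral;
  -- mean zero makes the latter minus the integral over the siblings.
  have hconst : ∀ x ∈ star n A, D x = D x₀ := fun x hx => apply_eq_of_mem_atomsOf hD hs hx₀ hx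
  have hl : ∫⁻ x in A \ unstarredSet ℱ star n, ‖D x‖ₑ ∂μ =
      ‖∫ x in A \ unstarredSet ℱ star n, D x ∂μ‖ₑ := by
    rw [diff_unstarredSet hℱ hstar hA, setIntegral_congr_fun hsm hconst,
      setLIntegral_congr_fun (g := fun _ => ‖D x₀‖ₑ) hsm fun x hx => by
        simp only [hconst x hx], setIntegral_const,
      setLIntegral_const, enorm_smul, mul_comm, Real.enorm_eq_ofReal measureReal_nonneg,
      ofReal_measureReal]
  rw [hl, ← neg_eq_of_add_eq_zero_right hsplit.symm, enorm_neg]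
  exact enorm_integral_le_lintegral_enorm _

/-- Both sides integrate `g` against measures of density `‖D‖ₑ`. These are compared on `ℱ n` atom by
atom. -/
theorem setLIntegral_compl_unstarredSet_le [IsFiniteMeasure μ] [CompleteSpace X]
    (hℱ : IsFilteredProbabilitySpace μ ℱ)
    (hstar : IsLargestChild μ ℱ star) {n : ℕ} {D : Ω → X} (hD : StronglyMeasurable[ℱ (n + 1)] D)
    (hint : Integrable D μ) (h0 : ∀ A, MeasurableSet[ℱ n] A → ∫ x in A, D x ∂μ = 0)
    {g : Ω → ℝ≥0∞} (hg : Measurable[ℱ n] g) :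
    ∫⁻ x in (unstarredSet ℱ star n)ᶜ, ‖D x‖ₑ * g x ∂μ ≤
      ∫⁻ x in unstarredSet ℱ star n, ‖D x‖ₑ * g x ∂μ := by
  have hU : MeasurableSet (unstarredSet ℱ star n) :=
    ℱ.le _ _ (measurableSet_unstarredSet hℱ n)
  have hDm : Measurable fun x => ‖D x‖ₑ := (hD.mono (ℱ.le _)).enorm
  have hgm : Measurable g := hg.mono (ℱ.le _) le_rfl
  have key := lintegral_le_lintegral_of_forall_measurableSet (ℱ.le n) (g := g)
    (μ₁ := (μ.restrict (unstarredSet ℱ star n)ᶜ).withDensity fun x => ‖D x‖ₑ)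
    (μ₂ := (μ.restrict (unstarredSet ℱ star n)).withDensity fun x => ‖D x‖ₑ) ?_ hg
  · rw [lintegral_withDensity_eq_lintegral_mul _ hDm hgm,
      lintegral_withDensity_eq_lintegral_mul _ hDm hgm] at key
    exact key
  · intro S hS
    have hSm := ℱ.le _ _ hS
    rw [withDensity_apply _ hSm, withDensity_apply _ hSm, Measure.restrict_restrict hSm,
      Measure.restrict_restrict hSm,
      lintegral_inter_eq_tsum_atomsOf (hℱ.purelyAtomic n) (ℱ.le n) (hSm.inter hU.compl),
      lintegral_inter_eq_tsum_atomsOf (hℱ.purelyAtomic n) (ℱ.le n) (hSm.inter hU)]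
    refine ENNReal.tsum_le_tsum fun A => ?_
    rcases subset_or_disjoint_of_mem_atomsOf A.2 hS with h | h
    · have h1 : ∀ T : Set Ω, S ∩ T ∩ (A : Set Ω) = (A : Set Ω) ∩ T := fun T => by
        rw [Set.inter_right_comm, Set.inter_eq_right.2 h]
      rw [h1, h1, ← Set.sdiff_eq]
      exact setLIntegral_enorm_diff_le hℱ hstar hD hint A.2 (h0 _ A.2.1)
    · rw [Set.inter_right_comm, Set.disjoint_iff_inter_eq_empty.1 h.symm]
      simp

end MeanZero

/-! ### The absorption argument. -/

section MainEstimate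

variable {Ω : Type u} {mΩ : MeasurableSpace Ω} {μ : Measure Ω} {ℱ : Filtration ℕ mΩ}
  {star : ℕ → Set Ω → Set Ω}

/-- Needed to cancel a finite quantity when half of the left side is absorbed. -/
theorem lintegral_sum_rpow_ne_top {p : ℝ} (hp : 1 ≤ p) {d : ℕ → Ω → ℝ≥0∞}
    (hd : ∀ n, Measurable (d n)) {s : Finset ℕ} (hfin : ∀ n ∈ s, ∫⁻ x, d n x ^ p ∂μ ≠ ∞) :
    ∫⁻ x, (∑ n ∈ s, d n x) ^ p ∂μ ≠ ∞ := by
  refine ne_top_of_le_ne_top ?_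
    (lintegral_mono fun x => ENNReal.rpow_sum_le_const_mul_sum_rpow s (fun n => d n x) hp)
  rw [lintegral_const_mul _ (Finset.measurable_sum _ fun n _ => (hd n).pow_const p),
    lintegral_finsetSum _ fun n _ => (hd n).pow_const p]
  refine ENNReal.mul_ne_top ?_ (ENNReal.sum_ne_top.2 hfin)
  exact ENNReal.rpow_ne_top_of_nonneg (by linarith) (ENNReal.natCast_ne_top _)

/-- The upper `ℓ^p` estimate for sums of adapted nonnegative functions whose mass on the selected
children is dominated by the mass on the others. -/
theorem lintegral_sum_rpow_le [IsFiniteMeasure μ] (hℱ : IsFilteredProbabilitySpace μ ℱ)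
    (hstar : IsLargestChild μ ℱ star) {p : ℝ} (hp1 : 1 < p) (hp2 : p ≤ 2)
    (hE : carlesonConst μ (unstarredAtoms ℱ star) < ∞) {d : ℕ → Ω → ℝ≥0∞}
    (hd : ∀ n, Measurable[ℱ n] (d n))
    (hdom : ∀ n, ∀ g : Ω → ℝ≥0∞, Measurable[ℱ n] g →
      ∫⁻ x in (unstarredSet ℱ star n)ᶜ, d (n + 1) x * g x ∂μ ≤
        ∫⁻ x in unstarredSet ℱ star n, d (n + 1) x * g x ∂μ) (N : ℕ) :
    ∫⁻ x, (∑ k ∈ Finset.range (N + 1), d k x) ^ p ∂μ ≤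
      8 * (4 * carlesonConst μ (unstarredAtoms ℱ star) + 1) ^ (p - 1) *
        ∑ k ∈ Finset.range (N + 1), ∫⁻ x, d k x ^ p ∂μ := by
  have hp0 : 0 < p := by linarith
  set c := carlesonConst μ (unstarredAtoms ℱ star) with hc
  -- The `4 * c` yields `2 * L⁻¹ * c ≤ 1/2` for the absorption; the `+ 1` ensures `L ≥ 1`.
  set L : ℝ≥0∞ := 4 * c + 1 with hLdef
  have hL1 : 1 ≤ L := le_add_self
  have hL0 : L ≠ 0 := (zero_lt_one.trans_le hL1).ne'
  have hLt : L ≠ ∞ := by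
    simp [hLdef, ENNReal.mul_eq_top, hE.ne]
  set Q : ℝ≥0∞ := L ^ (p - 1) with hQ
  have hQ1 : 1 ≤ Q := ENNReal.one_le_rpow hL1 (by linarith)
  set H : ℕ → Ω → ℝ≥0∞ := fun n x => ∑ k ∈ Finset.range (n + 1), d k x with hH
  have hHm : ∀ n, Measurable[ℱ n] (H n) := fun n =>
    Finset.measurable_sum _ fun k hk => (hd k).mono
      (ℱ.mono (Nat.lt_succ_iff.1 (Finset.mem_range.1 hk))) le_rfl
  have hdm : ∀ n, Measurable (d n) := fun n => (hd n).mono (ℱ.le n) le_rfl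
  have hHm' : ∀ n, Measurable (H n) := fun n => (hHm n).mono (ℱ.le n) le_rfl
  have hprod : ∀ n, Measurable fun x => d (n + 1) x * H n x ^ (p - 1) := fun n =>
    (hdm _).mul ((hHm' n).pow_const _)
  have hHmono : Monotone fun n x => H n x ^ p := by
    intro i j hij x
    exact ENNReal.rpow_le_rpow
      (Finset.sum_le_sum_of_subset (Finset.range_mono (Nat.succ_le_succ hij))) hp0.le
  by_cases hfin : ∀ n ∈ Finset.range (N + 1), ∫⁻ x, d n x ^ p ∂μ ≠ ∞
  swap
  · push Not at hfin
    rw [ENNReal.sum_eq_top.2 hfin, ENNReal.mul_top]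
    · exact le_top
    · exact mul_ne_zero (by norm_num) (zero_lt_one.trans_le hQ1).ne'
  have hYfin : ∫⁻ x, H N x ^ p ∂μ ≠ ∞ := lintegral_sum_rpow_ne_top hp1.le hdm hfin
  have hp2' : ENNReal.ofReal p ≤ 2 := by
    simpa using ENNReal.ofReal_le_ofReal hp2
  have hstep : ∀ n, ∫⁻ x, H (n + 1) x ^ p ∂μ ≤ ∫⁻ x, H n x ^ p ∂μ +
      2 * L⁻¹ * ∫⁻ x in unstarredSet ℱ star n, H n x ^ p ∂μ +
        4 * Q * ∫⁻ x, d (n + 1) x ^ p ∂μ := by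
    intro n
    set U := unstarredSet ℱ star n
    have hU : MeasurableSet U := ℱ.le _ _ (measurableSet_unstarredSet hℱ n)
    -- `H n ^ (p - 1)` is an admissible weight in `hdom`. Moving to `U` before using Young puts `H n
    -- ^ p` only on `U`, where Carleson embedding controls it.
    have hcross : ENNReal.ofReal p * ∫⁻ x, d (n + 1) x * H n x ^ (p - 1) ∂μ ≤
        2 * (Q * ∫⁻ x, d (n + 1) x ^ p ∂μ + L⁻¹ * ∫⁻ x in U, H n x ^ p ∂μ) := by
      calc ENNReal.ofReal p * ∫⁻ x, d (n + 1) x * H n x ^ (p - 1) ∂μ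
          ≤ ENNReal.ofReal p * (2 * ∫⁻ x in U, d (n + 1) x * H n x ^ (p - 1) ∂μ) := by
            gcongr
            rw [← lintegral_add_compl _ hU, two_mul]
            gcongr 1
            exact hdom n _ ((hHm n).pow_const _)
        _ = 2 * ∫⁻ x in U, ENNReal.ofReal p * (d (n + 1) x * H n x ^ (p - 1)) ∂μ := by
            rw [lintegral_const_mul _ (hprod n)]
            ring
        _ ≤ 2 * ∫⁻ x in U, (Q * d (n + 1) x ^ p + L⁻¹ * H n x ^ p) ∂μ := by
            gcongr with x
            exact ENNReal.mul_rpow_sub_one_le hp1 hp2 hL0 hLt _ _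
        _ = 2 * (Q * ∫⁻ x in U, d (n + 1) x ^ p ∂μ + L⁻¹ * ∫⁻ x in U, H n x ^ p ∂μ) := by
            rw [lintegral_add_left (((hdm _).pow_const _).const_mul _),
              lintegral_const_mul _ ((hdm _).pow_const _),
              lintegral_const_mul _ ((hHm' _).pow_const _)]
        _ ≤ _ := by
            gcongr
            exact Measure.restrict_le_self
    calc ∫⁻ x, H (n + 1) x ^ p ∂μ
        ≤ ∫⁻ x, (H n x ^ p + ENNReal.ofReal p * (d (n + 1) x * H n x ^ (p - 1)) +
            ENNReal.ofReal p * d (n + 1) x ^ p) ∂μ := by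
          refine lintegral_mono fun x => ?_
          simp only [hH, Finset.sum_range_succ _ (n + 1)]
          exact ENNReal.add_rpow_le_add_mul hp1 hp2 _ _
      _ = ∫⁻ x, H n x ^ p ∂μ + ENNReal.ofReal p * ∫⁻ x, d (n + 1) x * H n x ^ (p - 1) ∂μ +
            ENNReal.ofReal p * ∫⁻ x, d (n + 1) x ^ p ∂μ := by
          rw [lintegral_add_right _ (((hdm _).pow_const _).const_mul _),
            lintegral_add_left ((hHm' _).pow_const _),
            lintegral_const_mul _ (hprod n),
            lintegral_const_mul _ ((hdm _).pow_const _)]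
      _ ≤ ∫⁻ x, H n x ^ p ∂μ +
            2 * (Q * ∫⁻ x, d (n + 1) x ^ p ∂μ + L⁻¹ * ∫⁻ x in U, H n x ^ p ∂μ) +
            2 * Q * ∫⁻ x, d (n + 1) x ^ p ∂μ := by
          gcongr
          exact hp2'.trans (le_mul_of_one_le_right' hQ1)
      _ = _ := by ring
  have hind : ∀ n, ∫⁻ x, H n x ^ p ∂μ ≤
      2 * L⁻¹ * ∑ k ∈ Finset.range n, ∫⁻ x in unstarredSet ℱ star k, H k x ^ p ∂μ +
        4 * Q * ∑ k ∈ Finset.range (n + 1), ∫⁻ x, d k x ^ p ∂μ := by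
    intro n
    induction n with
    | zero =>
      simp only [hH, zero_add, Finset.range_one, Finset.sum_singleton, Finset.range_zero,
        Finset.sum_empty, mul_zero]
      refine le_mul_of_one_le_left' (one_le_mul_of_one_le_of_one_le ?_ hQ1)
      norm_num
    | succ n ih =>
      refine (hstep n).trans ?_
      rw [Finset.sum_range_succ _ n, Finset.sum_range_succ _ (n + 1), mul_add, mul_add]
      calc _ ≤ 2 * L⁻¹ * ∑ k ∈ Finset.range n, ∫⁻ x in unstarredSet ℱ star k, H k x ^ p ∂μ +
            4 * Q * ∑ k ∈ Finset.range (n + 1), ∫⁻ x, d k x ^ p ∂μ + _ + _ := by gcongr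
        _ = _ := by ring
  have hcar := sum_setLIntegral_unstarredSet_le_of_monotone hℱ hstar N
    (h := fun n x => H n x ^ p) (fun n => (hHm n).pow_const p) hHmono
  have hhalf : 2 * L⁻¹ * c ≤ 2⁻¹ := by
    have h1 : L⁻¹ * (4 * c) ≤ 1 := by
      calc L⁻¹ * (4 * c) ≤ L⁻¹ * L := by gcongr; exact le_self_add
        _ = 1 := ENNReal.inv_mul_cancel hL0 hLt
    calc 2 * L⁻¹ * c = 2⁻¹ * (2 * 2) * L⁻¹ * c := by
          rw [← mul_assoc, ENNReal.inv_mul_cancel (by norm_num) (by norm_num), one_mul]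
      _ = 2⁻¹ * (L⁻¹ * (4 * c)) := by ring
      _ ≤ 2⁻¹ * 1 := by gcongr
      _ = 2⁻¹ := mul_one _
  set Y := ∫⁻ x, H N x ^ p ∂μ with hY
  set e := ∑ k ∈ Finset.range (N + 1), ∫⁻ x, d k x ^ p ∂μ
  -- Cancelling `Y / 2` leaves `Y / 2 ≤ 4 * Q * e`, hence the factor `8`.
  have hYle : Y ≤ 2⁻¹ * Y + 4 * Q * e := by
    refine (hind N).trans (add_le_add_left ?_ _)
    refine (mul_le_mul_right hcar _).trans ?_
    rw [← mul_assoc]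
    exact mul_le_mul_left hhalf _
  have hYY : Y = 2⁻¹ * Y + 2⁻¹ * Y := by
    rw [← add_mul, ENNReal.inv_two_add_inv_two, one_mul]
  have hhalfY : 2⁻¹ * Y ≤ 4 * Q * e := by
    refine (ENNReal.add_le_add_iff_left (a := 2⁻¹ * Y) ?_).1 ?_
    · exact ENNReal.mul_ne_top (by norm_num) hYfin
    · rw [← hYY]
      exact hYle
  rw [hYY]
  calc _ ≤ 4 * Q * e + 4 * Q * e := by gcongr
    _ = 8 * Q * e := by ring

end MainEstimate

/-! ### Vector-valued Lévy convergence and Fatou. -/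

section Levy

open Filter Topology

variable {Ω : Type u} {mΩ : MeasurableSpace Ω} {μ : Measure Ω} {ℱ : Filtration ℕ mΩ}
  {X : Type v} [NormedAddCommGroup X] [NormedSpace ℝ X] [CompleteSpace X]

/-- The real-valued theorem for the indicator of `s` is transported by `t ↦ t • c`, which commutes
with conditional expectation. -/
theorem tendsto_eLpNorm_condExp_indicator_const [IsFiniteMeasure μ]
    (hsup : ⨆ n, (ℱ n : MeasurableSpace Ω) = mΩ) {s : Set Ω} (hs : MeasurableSet s) (c : X) :
    Tendsto (fun n => eLpNorm (μ[s.indicator fun _ => c|ℱ n] - s.indicator fun _ => c) 1 μ) atTop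
      (𝓝 0) := by
  let T : ℝ →L[ℝ] X := ContinuousLinearMap.toSpanSingleton ℝ c
  let g : Ω → ℝ := s.indicator fun _ => 1
  have hg : Integrable g μ := (integrable_const 1).indicator hs
  have hgm : StronglyMeasurable[⨆ n, (ℱ n : MeasurableSpace Ω)] g := by
    rw [hsup]
    exact stronglyMeasurable_const.indicator hs
  have hTg : T ∘ g = s.indicator fun _ => c := by
    ext x
    by_cases hx : x ∈ s <;> simp [T, g, hx]
  have hreal := hg.tendsto_eLpNorm_condExp (μ := μ) (ℱ := ℱ) hgm
  have hreal' := ENNReal.Tendsto.const_mul (a := (‖c‖₊ : ℝ≥0∞)) hreal (Or.inr ENNReal.coe_ne_top)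
  rw [mul_zero] at hreal'
  refine tendsto_of_tendsto_of_tendsto_of_le_of_le tendsto_const_nhds hreal' (fun _ => zero_le)
    fun n => ?_
  refine eLpNorm_le_nnreal_smul_eLpNorm_of_ae_le_mul ?_ 1
  rw [← hTg]
  filter_upwards [T.comp_condExp_comm (m := ℱ n) hg] with x hx
  rw [Pi.sub_apply, ← hx, Function.comp_apply, Function.comp_apply, ← map_sub, mul_comm]
  simp [T, nnnorm_smul]

/-- **Lévy's upward theorem** in `L¹` for functions with values in a Banach space. -/
theorem tendsto_eLpNorm_condExp_sub [IsFiniteMeasure μ]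
    (hsup : ⨆ n, (ℱ n : MeasurableSpace Ω) = mΩ) {f : Ω → X} (hf : Integrable f μ) :
    Tendsto (fun n => eLpNorm (μ[f|ℱ n] - f) 1 μ) atTop (𝓝 0) := by
  rw [ENNReal.tendsto_nhds_zero]
  intro ε hε
  have hε3 : ε / 3 ≠ 0 := (ENNReal.div_pos hε.ne' (by norm_num)).ne'
  -- Density: approximate `f` in `L¹` within `ε / 3`. The error `f - g` is paid twice, once under
  -- the contraction `μ[·|ℱ n]`.
  obtain ⟨g, hfg, hg, hlim⟩ := (memLp_one_iff_integrable.2 hf).induction_dense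
    (P := fun g => Integrable g μ ∧
      Tendsto (fun n => eLpNorm (μ[g|ℱ n] - g) 1 μ) atTop (𝓝 0)) ENNReal.one_ne_top
    (fun c s hs _ ε _ => ⟨s.indicator fun _ => c, by simp,
      (integrable_const c).indicator hs, tendsto_eLpNorm_condExp_indicator_const hsup hs c⟩)
    (by
      rintro g h ⟨hg, hglim⟩ ⟨hh, hhlim⟩
      refine ⟨hg.add hh, ?_⟩
      have := hglim.add hhlim
      rw [add_zero] at this
      refine tendsto_of_tendsto_of_tendsto_of_le_of_le tendsto_const_nhds this
        (fun _ => zero_le) fun n => ?_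
      refine le_trans (le_of_eq (eLpNorm_congr_ae ?_))
        (eLpNorm_add_le (integrable_condExp.sub hg).1 (integrable_condExp.sub hh).1 le_rfl)
      filter_upwards [condExp_add hg hh (ℱ n)] with x hx
      simp only [Pi.sub_apply, Pi.add_apply, hx]
      abel)
    (fun g hg => hg.1.1) hε3
  filter_upwards [ENNReal.tendsto_nhds_zero.1 hlim (ε / 3) (pos_iff_ne_zero.2 hε3)] with n hn
  have hae : μ[f|ℱ n] - f =ᵐ[μ] μ[f - g|ℱ n] + ((μ[g|ℱ n] - g) - (f - g)) := by
    filter_upwards [condExp_sub hf hg (ℱ n)] with x hx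
    simp only [Pi.sub_apply, Pi.add_apply, hx]
    abel
  rw [eLpNorm_congr_ae hae]
  calc _ ≤ eLpNorm (μ[f - g|ℱ n]) 1 μ + eLpNorm ((μ[g|ℱ n] - g) - (f - g)) 1 μ :=
        eLpNorm_add_le integrable_condExp.1 ((integrable_condExp.sub hg).sub (hf.sub hg)).1 le_rfl
    _ ≤ eLpNorm (f - g) 1 μ + (eLpNorm (μ[g|ℱ n] - g) 1 μ + eLpNorm (f - g) 1 μ) :=
        add_le_add (eLpNorm_condExp_le_eLpNorm _ le_rfl)
          (eLpNorm_sub_le (integrable_condExp.sub hg).1 (hf.sub hg).1 le_rfl)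
    _ ≤ ε / 3 + (ε / 3 + ε / 3) := by gcongr
    _ = ε := by rw [← add_assoc, ENNReal.add_thirds]

/-- `L¹` convergence gives an a.e. convergent subsequence, along which the `L^q` norm is lower
semicontinuous. -/
theorem eLpNorm_le_of_forall_eLpNorm_condExp_le [IsFiniteMeasure μ]
    (hsup : ⨆ n, (ℱ n : MeasurableSpace Ω) = mΩ) {f : Ω → X} (hf : Integrable f μ)
    {q K : ℝ≥0∞} (hK : ∀ n, eLpNorm (μ[f|ℱ n]) q μ ≤ K) : eLpNorm f q μ ≤ K := by
  obtain ⟨ns, -, hns⟩ := (tendstoInMeasure_of_tendsto_eLpNorm one_ne_zero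
    (fun n => (integrable_condExp (m := ℱ n)).1) hf.1
      (tendsto_eLpNorm_condExp_sub hsup hf)).exists_seq_tendsto_ae
  exact Lp.eLpNorm_le_of_ae_tendsto (Eventually.of_forall fun n => hK (ns n))
    (fun n => integrable_condExp.1) hns

end Levy

/-! ### Signed powers on the real line. -/

section SignedPower

/-- The odd extension of `x ↦ x ^ q` to the real line. -/
noncomputable def signedRpow (q x : ℝ) : ℝ := if 0 ≤ x then |x| ^ q else -|x| ^ q

theorem abs_signedRpow (q x : ℝ) : |signedRpow q x| = |x| ^ q := by
  unfold signedRpow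
  split_ifs <;> simp [abs_of_nonneg (Real.rpow_nonneg (abs_nonneg x) q)]

theorem measurable_signedRpow (q : ℝ) : Measurable (signedRpow q) := by
  have h : Measurable fun x : ℝ => |x| ^ q := measurable_id.abs.pow_const q
  exact Measurable.ite measurableSet_Ici h h.neg

theorem mul_signedRpow_sub_one {p : ℝ} (hp : 1 < p) (x : ℝ) :
    x * signedRpow (p - 1) x = |x| ^ p := by
  rw [← self_mul_rpow_sub_one hp (abs_nonneg x)]
  unfold signedRpow
  split_ifs with h
  · rw [abs_of_nonneg h]
  · rw [abs_of_neg (not_le.1 h)]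
    ring

theorem abs_rpow_sub_rpow_le {q : ℝ} (hq0 : 0 ≤ q) (hq1 : q ≤ 1) {x y : ℝ} (hx : 0 ≤ x)
    (hy : 0 ≤ y) : |y ^ q - x ^ q| ≤ |y - x| ^ q := by
  wlog hxy : x ≤ y generalizing x y
  · rw [abs_sub_comm, abs_sub_comm y]
    exact this hy hx (not_le.1 hxy).le
  · have h := Real.rpow_add_le_add_rpow hx (sub_nonneg.2 hxy) hq0 hq1
    rw [add_sub_cancel] at h
    rw [abs_of_nonneg (sub_nonneg.2 hxy),
      abs_of_nonneg (sub_nonneg.2 (Real.rpow_le_rpow hx hxy hq0))]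
    linarith

/-- For equal signs this is subadditivity of `t ^ q`. For opposite signs `|x|` and `|y|` are both at
most `|y - x|`, whence the `2`. -/
theorem abs_signedRpow_sub_le {q : ℝ} (hq0 : 0 ≤ q) (hq1 : q ≤ 1) (x y : ℝ) :
    |signedRpow q y - signedRpow q x| ≤ 2 * |y - x| ^ q := by
  have hsame := abs_rpow_sub_rpow_le hq0 hq1 (abs_nonneg x) (abs_nonneg y)
  have hnn : 0 ≤ |y - x| ^ q := Real.rpow_nonneg (abs_nonneg _) q
  have hle : |(|y| - |x|)| ^ q ≤ |y - x| ^ q :=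
    Real.rpow_le_rpow (abs_nonneg _) (abs_abs_sub_abs_le y x) hq0
  have hopp : |x| ≤ |y - x| → |y| ≤ |y - x| → |(|y| ^ q + |x| ^ q)| ≤ 2 * |y - x| ^ q := by
    intro h1 h2
    rw [abs_of_nonneg (by positivity)]
    have := Real.rpow_le_rpow (abs_nonneg x) h1 hq0
    have := Real.rpow_le_rpow (abs_nonneg y) h2 hq0
    linarith
  unfold signedRpow
  split_ifs with hy hx hx
  · linarith
  · rw [sub_neg_eq_add]
    push Not at hx
    refine hopp ?_ ?_
    · rw [abs_of_neg hx, abs_of_nonneg (by linarith)]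
      linarith
    · rw [abs_of_nonneg hy, abs_of_nonneg (by linarith)]
      linarith
  · rw [← neg_add', abs_neg]
    push Not at hy
    refine hopp ?_ ?_
    · rw [abs_of_nonneg hx, abs_of_neg (by linarith)]
      linarith
    · rw [abs_of_neg hy, abs_of_neg (by linarith)]
      linarith
  · rw [neg_sub_neg, abs_sub_comm]
    linarith

/-- The elementary inequality behind the martingale type of the real line. -/
theorem abs_add_rpow_le {p : ℝ} (hp1 : 1 < p) (hp2 : p ≤ 2) (x d : ℝ) :
    |x + d| ^ p ≤ |x| ^ p + p * (signedRpow (p - 1) x * d) + 2 * p * |d| ^ p := by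
  have hp0 : 0 < p := by linarith
  -- `h1`, `h2` and `h3` give convexity at `x + d`, with linear term `p * d * signedRpow (p - 1) (x
  -- + d)`. Replacing the base point by `x` costs the Hölder error `h4`.
  have h1 := young_rpow_sub_one hp1 (abs_nonneg x) (abs_nonneg (x + d))
  have h2 : x * signedRpow (p - 1) (x + d) ≤ |x| * |x + d| ^ (p - 1) := by
    rw [← abs_signedRpow, ← abs_mul]
    exact le_abs_self _
  have h3 := mul_signedRpow_sub_one hp1 (x + d)
  have h4 : d * (signedRpow (p - 1) (x + d) - signedRpow (p - 1) x) ≤ 2 * |d| ^ p := by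
    refine (le_abs_self _).trans ?_
    rw [abs_mul, ← self_mul_rpow_sub_one hp1 (abs_nonneg d)]
    have := abs_signedRpow_sub_le (q := p - 1) (by linarith) (by linarith) x (x + d)
    rw [add_sub_cancel_left] at this
    calc _ ≤ |d| * (2 * |d| ^ (p - 1)) := mul_le_mul_of_nonneg_left this (abs_nonneg d)
      _ = _ := by ring
  have h2' := mul_le_mul_of_nonneg_left h2 hp0.le
  have h4' := mul_le_mul_of_nonneg_left h4 hp0.le
  nlinarith

end SignedPower

/-! ### Martingale differences and reduction to finite levels. -/

section MartingaleDifferences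

variable {Ω : Type u} {mΩ : MeasurableSpace Ω} {μ : Measure Ω} {ℱ : Filtration ℕ mΩ}
  {X : Type v} [NormedAddCommGroup X]

theorem eLpNorm_ofReal_rpow {p : ℝ} (hp : 0 < p) (f : Ω → X) :
    eLpNorm f (ENNReal.ofReal p) μ ^ p = ∫⁻ x, ‖f x‖ₑ ^ p ∂μ := by
  rw [eLpNorm_eq_lintegral_rpow_enorm_toReal (by simpa using hp) ENNReal.ofReal_ne_top,
    ENNReal.toReal_ofReal hp.le, ← ENNReal.rpow_mul, one_div, inv_mul_cancel₀ hp.ne',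
    ENNReal.rpow_one]

variable [NormedSpace ℝ X] [CompleteSpace X]

theorem martingaleDiffNorm_rpow {p : ℝ} (hp : 0 < p) (f : Ω → X) :
    martingaleDiffNorm μ ℱ p f ^ p = ‖∫ ω, f ω ∂μ‖ₑ ^ p +
      ∑' n : ℕ, ∫⁻ x, ‖(μ[f|ℱ (n + 1)] - μ[f|ℱ n]) x‖ₑ ^ p ∂μ := by
  rw [martingaleDiffNorm, ← ENNReal.rpow_mul, one_div, inv_mul_cancel₀ hp.ne', ENNReal.rpow_one]
  simp only [eLpNorm_ofReal_rpow hp]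

theorem setIntegral_condExp_sub_eq_zero [IsFiniteMeasure μ] {f : Ω → X} (hf : Integrable f μ)
    (n : ℕ) {A : Set Ω} (hA : MeasurableSet[ℱ n] A) :
    ∫ x in A, (μ[f|ℱ (n + 1)] - μ[f|ℱ n]) x ∂μ = 0 := by
  simp only [Pi.sub_apply]
  rw [integral_sub integrable_condExp.integrableOn integrable_condExp.integrableOn,
    setIntegral_condExp (ℱ.le _) hf hA, setIntegral_condExp (ℱ.le _) hf (ℱ.mono n.le_succ _ hA),
    sub_self]

theorem eLpNorm_le_mul_martingaleDiffNorm [IsFiniteMeasure μ]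
    (hℱ : IsFilteredProbabilitySpace μ ℱ) {p : ℝ} (hp : 0 < p) {f : Ω → X} (hf : Integrable f μ)
    {C : ℝ≥0∞} (h : ∀ n, ∫⁻ x, ‖(μ[f|ℱ n]) x‖ₑ ^ p ∂μ ≤ C ^ p * martingaleDiffNorm μ ℱ p f ^ p) :
    eLpNorm f (ENNReal.ofReal p) μ ≤ C * martingaleDiffNorm μ ℱ p f := by
  refine eLpNorm_le_of_forall_eLpNorm_condExp_le hℱ.iSup_eq hf fun n => ?_
  rw [← ENNReal.rpow_le_rpow_iff hp, ENNReal.mul_rpow_of_nonneg _ _ hp.le, eLpNorm_ofReal_rpow hp]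
  exact h n

theorem condExp_zero_eq_const [IsProbabilityMeasure μ] (hℱ : IsFilteredProbabilitySpace μ ℱ)
    (f : Ω → X) : μ[f|ℱ 0] = fun _ => ∫ ω, f ω ∂μ := by
  rw [hℱ.zero_eq, condExp_bot]

end MartingaleDifferences

/-! ### Martingale type of the real line. -/

section RealMartingales

variable {Ω : Type u} {mΩ : MeasurableSpace Ω} {μ : Measure Ω} {ℱ : Filtration ℕ mΩ}

theorem ofReal_integral_abs_rpow {p : ℝ} (hp : 0 < p) {f : Ω → ℝ}
    (hf : Integrable (fun x => |f x| ^ p) μ) :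
    ENNReal.ofReal (∫ x, |f x| ^ p ∂μ) = ∫⁻ x, ‖f x‖ₑ ^ p ∂μ := by
  rw [ofReal_integral_eq_lintegral_ofReal hf
    (Filter.Eventually.of_forall fun x => Real.rpow_nonneg (abs_nonneg _) _)]
  refine lintegral_congr fun x => ?_
  rw [← ENNReal.ofReal_rpow_of_nonneg (abs_nonneg _) hp.le, Real.enorm_eq_ofReal_abs]

theorem integrable_abs_rpow {p : ℝ} (hp : 0 < p) {f : Ω → ℝ}
    (hf : MemLp f (ENNReal.ofReal p) μ) : Integrable (fun x => |f x| ^ p) μ := by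
  have := hf.integrable_norm_rpow (by simpa using hp) ENNReal.ofReal_ne_top
  simpa only [ENNReal.toReal_ofReal hp.le, Real.norm_eq_abs] using this

theorem memLp_signedRpow {p : ℝ} (hp : 1 < p) {f : Ω → ℝ}
    (hf : MemLp f (ENNReal.ofReal p) μ) :
    MemLp (fun x => signedRpow (p - 1) (f x)) (ENNReal.ofReal (Real.conjExponent p)) μ := by
  have hp1 : 0 < p - 1 := by linarith
  have hq : 0 < Real.conjExponent p := (Real.HolderConjugate.conjExponent hp).symm.pos
  have hm : AEStronglyMeasurable (fun x => signedRpow (p - 1) (f x)) μ :=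
    ((measurable_signedRpow _).comp_aemeasurable hf.1.aemeasurable).aestronglyMeasurable
  rw [← integrable_norm_rpow_iff hm (by simpa using hq) ENNReal.ofReal_ne_top,
    ENNReal.toReal_ofReal hq.le]
  convert integrable_abs_rpow (by linarith) hf using 2 with x
  rw [Real.norm_eq_abs, abs_signedRpow, ← Real.rpow_mul (abs_nonneg _), Real.conjExponent,
    mul_div_cancel₀ _ hp1.ne']

/-- Hölder gives integrability. The signed power is `ℱ n`-measurable, so it comes out of `μ[·|ℱ n]`,
which kills the difference. -/
theorem integral_signedRpow_mul_condExp_sub [IsFiniteMeasure μ] {p : ℝ} (hp : 1 < p)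
    {f : Ω → ℝ} (hf : MemLp f (ENNReal.ofReal p) μ) (n : ℕ) :
    Integrable (fun x => signedRpow (p - 1) ((μ[f|ℱ n]) x) *
      (μ[f|ℱ (n + 1)] - μ[f|ℱ n]) x) μ ∧
    ∫ x, signedRpow (p - 1) ((μ[f|ℱ n]) x) * (μ[f|ℱ (n + 1)] - μ[f|ℱ n]) x ∂μ = 0 := by
  have hp1 : 1 ≤ ENNReal.ofReal p := by
    simpa using ENNReal.ofReal_le_ofReal hp.le
  have hfi : Integrable f μ := hf.integrable hp1
  have := (Real.HolderConjugate.conjExponent hp).symm.ennrealOfReal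
  have hD : MemLp (μ[f|ℱ (n + 1)] - μ[f|ℱ n]) (ENNReal.ofReal p) μ :=
    (hf.condExp hp1).sub (hf.condExp hp1)
  have hint : Integrable ((fun x => signedRpow (p - 1) ((μ[f|ℱ n]) x)) *
      (μ[f|ℱ (n + 1)] - μ[f|ℱ n])) μ :=
    (memLp_signedRpow hp (hf.condExp hp1)).integrable_mul hD
  refine ⟨hint, ?_⟩
  have hsm : StronglyMeasurable[ℱ n] fun x => signedRpow (p - 1) ((μ[f|ℱ n]) x) :=
    ((measurable_signedRpow _).comp stronglyMeasurable_condExp.measurable).stronglyMeasurable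
  have hpull := condExp_mul_of_stronglyMeasurable_left hsm hint (hD.integrable hp1)
  have hzero : μ[μ[f|ℱ (n + 1)] - μ[f|ℱ n]|ℱ n] =ᵐ[μ] 0 := by
    refine (condExp_sub integrable_condExp integrable_condExp _).trans ?_
    filter_upwards [condExp_condExp_of_le (f := f) (ℱ.mono n.le_succ) (ℱ.le (n + 1)),
      condExp_condExp_of_le (f := f) (le_refl (ℱ n : MeasurableSpace Ω)) (ℱ.le n)] with x h1 h2
    simp only [Pi.sub_apply, h1, h2, sub_self, Pi.zero_apply]
  calc _ = ∫ x, (μ[(fun x => signedRpow (p - 1) ((μ[f|ℱ n]) x)) *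
        (μ[f|ℱ (n + 1)] - μ[f|ℱ n])|ℱ n]) x ∂μ := (integral_condExp (ℱ.le n)).symm
    _ = ∫ _, (0 : ℝ) ∂μ := by
      refine integral_congr_ae ?_
      filter_upwards [hpull, hzero] with x h1 h2
      rw [h1, Pi.mul_apply, h2, Pi.zero_apply, mul_zero]
    _ = 0 := integral_zero _ _

theorem lintegral_condExp_succ_rpow_le [IsFiniteMeasure μ] {p : ℝ} (hp1 : 1 < p) (hp2 : p ≤ 2)
    {f : Ω → ℝ} (hf : MemLp f (ENNReal.ofReal p) μ) (n : ℕ) :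
    ∫⁻ x, ‖(μ[f|ℱ (n + 1)]) x‖ₑ ^ p ∂μ ≤ ∫⁻ x, ‖(μ[f|ℱ n]) x‖ₑ ^ p ∂μ +
      4 * ∫⁻ x, ‖(μ[f|ℱ (n + 1)] - μ[f|ℱ n]) x‖ₑ ^ p ∂μ := by
  have hp0 : 0 < p := by linarith
  have hpe : 1 ≤ ENNReal.ofReal p := by
    simpa using ENNReal.ofReal_le_ofReal hp1.le
  have hc : ∀ k, MemLp (μ[f|ℱ k]) (ENNReal.ofReal p) μ := fun k => hf.condExp hpe
  have i1 := integrable_abs_rpow hp0 (hc (n + 1))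
  have i2 := integrable_abs_rpow hp0 (hc n)
  have i3 := integrable_abs_rpow hp0 ((hc (n + 1)).sub (hc n))
  obtain ⟨i4, hz⟩ := integral_signedRpow_mul_condExp_sub (ℱ := ℱ) hp1 hf n
  have i5 : Integrable (fun x => |(μ[f|ℱ n]) x| ^ p + p * (signedRpow (p - 1) ((μ[f|ℱ n]) x) *
      (μ[f|ℱ (n + 1)] - μ[f|ℱ n]) x)) μ := i2.add (i4.const_mul p)
  have key : ∫ x, |(μ[f|ℱ (n + 1)]) x| ^ p ∂μ ≤ ∫ x, |(μ[f|ℱ n]) x| ^ p ∂μ +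
      4 * ∫ x, |(μ[f|ℱ (n + 1)] - μ[f|ℱ n]) x| ^ p ∂μ := by
    calc ∫ x, |(μ[f|ℱ (n + 1)]) x| ^ p ∂μ
        ≤ ∫ x, (|(μ[f|ℱ n]) x| ^ p + p * (signedRpow (p - 1) ((μ[f|ℱ n]) x) *
            (μ[f|ℱ (n + 1)] - μ[f|ℱ n]) x) +
            2 * p * |(μ[f|ℱ (n + 1)] - μ[f|ℱ n]) x| ^ p) ∂μ := by
          refine integral_mono i1 (i5.add (i3.const_mul (2 * p)))
            fun x => ?_
          have := abs_add_rpow_le hp1 hp2 ((μ[f|ℱ n]) x) ((μ[f|ℱ (n + 1)] - μ[f|ℱ n]) x)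
          simpa only [Pi.sub_apply, add_sub_cancel] using this
      _ = ∫ x, |(μ[f|ℱ n]) x| ^ p ∂μ +
            2 * p * ∫ x, |(μ[f|ℱ (n + 1)] - μ[f|ℱ n]) x| ^ p ∂μ := by
          rw [integral_add i5 (i3.const_mul (2 * p)),
            integral_add i2 (i4.const_mul p), integral_const_mul, integral_const_mul, hz, mul_zero,
            add_zero]
      _ ≤ _ := by
          have : 0 ≤ ∫ x, |(μ[f|ℱ (n + 1)] - μ[f|ℱ n]) x| ^ p ∂μ :=
            integral_nonneg fun x => Real.rpow_nonneg (abs_nonneg _) _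
          nlinarith
  rw [← ofReal_integral_abs_rpow hp0 i1, ← ofReal_integral_abs_rpow hp0 i2,
    ← ofReal_integral_abs_rpow hp0 i3]
  refine (ENNReal.ofReal_le_ofReal key).trans ?_
  rw [ENNReal.ofReal_add (integral_nonneg fun x => Real.rpow_nonneg (abs_nonneg _) _)
    (mul_nonneg (by norm_num) (integral_nonneg fun x => Real.rpow_nonneg (abs_nonneg _) _)),
    ENNReal.ofReal_mul (by norm_num)]
  simp

/-- The real line has martingale type `p` for `1 < p ≤ 2`. -/
theorem martingaleTypeConst_real_lt_top {p : ℝ} (hp1 : 1 < p) (hp2 : p ≤ 2) :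
    martingaleTypeConst.{u, 0} p ℝ < ∞ := by
  have hp0 : 0 < p := by linarith
  refine lt_of_le_of_lt (sInf_le (a := (4 : ℝ≥0∞)) ?_) (by norm_num)
  intro Ω mΩ μ ℱ _ hℱ f hf
  have hpe : 1 ≤ ENNReal.ofReal p := by
    simpa using ENNReal.ofReal_le_ofReal hp1.le
  refine eLpNorm_le_mul_martingaleDiffNorm hℱ hp0 (hf.integrable hpe) fun n => ?_
  have hind : ∀ n, ∫⁻ x, ‖(μ[f|ℱ n]) x‖ₑ ^ p ∂μ ≤ ‖∫ ω, f ω ∂μ‖ₑ ^ p +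
      4 * ∑ k ∈ Finset.range n, ∫⁻ x, ‖(μ[f|ℱ (k + 1)] - μ[f|ℱ k]) x‖ₑ ^ p ∂μ := by
    intro n
    induction n with
    | zero => simp [condExp_zero_eq_const hℱ]
    | succ n ih =>
      refine (lintegral_condExp_succ_rpow_le hp1 hp2 hf n).trans ?_
      rw [Finset.sum_range_succ, mul_add, ← add_assoc]
      gcongr
  have h4 : (4 : ℝ≥0∞) ≤ 4 ^ p := by
    conv_lhs => rw [← ENNReal.rpow_one 4]
    exact ENNReal.rpow_le_rpow_of_exponent_le (by norm_num) hp1.le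
  calc _ ≤ _ := hind n
    _ ≤ 4 * ‖∫ ω, f ω ∂μ‖ₑ ^ p +
        4 * ∑' k, ∫⁻ x, ‖(μ[f|ℱ (k + 1)] - μ[f|ℱ k]) x‖ₑ ^ p ∂μ := by
      gcongr
      · exact le_mul_of_one_le_left' (by norm_num)
      · exact ENNReal.sum_le_tsum _
    _ = 4 * martingaleDiffNorm μ ℱ p f ^ p := by rw [martingaleDiffNorm_rpow hp0, mul_add]
    _ ≤ _ := by gcongr

end RealMartingales

/-! ### The estimate for Banach-valued martingales. -/

section BanachMartingales

variable {Ω : Type u} {mΩ : MeasurableSpace Ω} {μ : Measure Ω} {ℱ : Filtration ℕ mΩ}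
  {star : ℕ → Set Ω → Set Ω} {X : Type v} [NormedAddCommGroup X] [NormedSpace ℝ X]
  [CompleteSpace X]

theorem lintegral_condExp_rpow_le [IsProbabilityMeasure μ] (hℱ : IsFilteredProbabilitySpace μ ℱ)
    (hstar : IsLargestChild μ ℱ star) {p : ℝ} (hp1 : 1 < p) (hp2 : p ≤ 2)
    (hE : carlesonConst μ (unstarredAtoms ℱ star) < ∞) {f : Ω → X} (hf : Integrable f μ) (N : ℕ) :
    ∫⁻ x, ‖(μ[f|ℱ N]) x‖ₑ ^ p ∂μ ≤
      8 * (4 * carlesonConst μ (unstarredAtoms ℱ star) + 1) ^ (p - 1) *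
        martingaleDiffNorm μ ℱ p f ^ p := by
  have hp0 : 0 < p := by linarith
  -- The index is shifted: `d 0` carries the mean and `d (k + 1)` the difference from level `k` to
  -- `k + 1`, so that `d n` is `ℱ n`-measurable.
  let d : ℕ → Ω → ℝ≥0∞ := fun n => Nat.casesOn n (fun _ => ‖∫ ω, f ω ∂μ‖ₑ)
    fun k x => ‖(μ[f|ℱ (k + 1)] - μ[f|ℱ k]) x‖ₑ
  have hDm : ∀ n, StronglyMeasurable[ℱ (n + 1)] (μ[f|ℱ (n + 1)] - μ[f|ℱ n]) := fun n =>
    stronglyMeasurable_condExp.sub (stronglyMeasurable_condExp.mono (ℱ.mono n.le_succ))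
  have hd : ∀ n, Measurable[ℱ n] (d n) := by
    rintro (_ | n)
    · exact measurable_const
    · exact (hDm n).enorm
  have hdom : ∀ n, ∀ g : Ω → ℝ≥0∞, Measurable[ℱ n] g →
      ∫⁻ x in (unstarredSet ℱ star n)ᶜ, d (n + 1) x * g x ∂μ ≤
        ∫⁻ x in unstarredSet ℱ star n, d (n + 1) x * g x ∂μ := fun n g hg =>
    setLIntegral_compl_unstarredSet_le hℱ hstar (hDm n)
      (integrable_condExp.sub integrable_condExp)
      (fun A hA => setIntegral_condExp_sub_eq_zero hf n hA) hg
  have hle : ∀ n x, ‖(μ[f|ℱ n]) x‖ₑ ≤ ∑ k ∈ Finset.range (n + 1), d k x := by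
    intro n x
    induction n with
    | zero => simp [d, condExp_zero_eq_const hℱ]
    | succ n ih =>
      rw [Finset.sum_range_succ]
      calc ‖(μ[f|ℱ (n + 1)]) x‖ₑ
          = ‖(μ[f|ℱ n]) x + (μ[f|ℱ (n + 1)] - μ[f|ℱ n]) x‖ₑ := by simp
        _ ≤ ‖(μ[f|ℱ n]) x‖ₑ + ‖(μ[f|ℱ (n + 1)] - μ[f|ℱ n]) x‖ₑ := enorm_add_le _ _
        _ ≤ _ := by gcongr
  calc ∫⁻ x, ‖(μ[f|ℱ N]) x‖ₑ ^ p ∂μ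
      ≤ ∫⁻ x, (∑ k ∈ Finset.range (N + 1), d k x) ^ p ∂μ :=
        lintegral_mono fun x => ENNReal.rpow_le_rpow (hle N x) hp0.le
    _ ≤ _ := lintegral_sum_rpow_le hℱ hstar hp1 hp2 hE hd hdom N
    _ ≤ _ := by
        gcongr
        rw [martingaleDiffNorm_rpow hp0, Finset.sum_range_succ', add_comm]
        gcongr
        · simp [d]
        · exact ENNReal.sum_le_tsum
            (f := fun n : ℕ => ∫⁻ x, ‖(μ[f|ℱ (n + 1)] - μ[f|ℱ n]) x‖ₑ ^ p ∂μ) _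

end BanachMartingales

/-! ### Comparison with the stated constant. -/

section Constant

/-- Since `1 / p ≤ 1`, one has `2 ^ (-(1 / p)) ≥ 1/2`: the first factor is at least `4`, the second
at least `2`. -/
theorem eight_le_upperConst_factor {p : ℝ} (hp1 : 1 < p) :
    8 ≤ (2 + 1 / (1 - (2 : ℝ) ^ (-(1 / p)))) * (2 : ℝ) ^ (2 - 1 / p) := by
  have hp0 : 0 < p := by linarith
  have hinv : 1 / p ≤ 1 := by rw [div_le_one hp0]; exact hp1.le
  have hinv0 : 0 < 1 / p := by positivity
  have h1 : (2 : ℝ) ^ (1 : ℝ) ≤ 2 ^ (2 - 1 / p) :=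
    Real.rpow_le_rpow_of_exponent_le (by norm_num) (by linarith)
  have h2 : (2 : ℝ) ^ (-1 : ℝ) ≤ 2 ^ (-(1 / p)) :=
    Real.rpow_le_rpow_of_exponent_le (by norm_num) (by linarith)
  have h3 : (2 : ℝ) ^ (-(1 / p)) < 1 :=
    Real.rpow_lt_one_of_one_lt_of_neg (by norm_num) (by linarith)
  rw [Real.rpow_one] at h1
  rw [Real.rpow_neg_one] at h2
  have h4 : 2 ≤ 1 / (1 - (2 : ℝ) ^ (-(1 / p))) := by
    rw [le_div_iff₀ (by linarith)]
    linarith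
  nlinarith

theorem upperConst_lt_top {p : ℝ} (hp : 1 < p) {M c : ℝ≥0∞} (hM : M < ∞) (hc : c < ∞) :
    upperConst p M c < ∞ := by
  have hinv : 1 / p ≤ 1 := by rw [div_le_one (by linarith)]; exact hp.le
  refine ENNReal.mul_lt_top (ENNReal.mul_lt_top ENNReal.ofReal_lt_top ?_) ?_
  · refine ENNReal.rpow_lt_top_of_nonneg (by positivity) (ENNReal.add_ne_top.2 ⟨by simp, ?_⟩)
    exact ENNReal.rpow_ne_top_of_nonneg (by linarith) hM.ne
  · exact ENNReal.rpow_lt_top_of_nonneg (by linarith)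
      (ENNReal.add_ne_top.2 ⟨ENNReal.mul_ne_top (by norm_num) hc.ne, by simp⟩)

theorem mul_rpow_le_upperConst {p : ℝ} (hp : 1 < p) (M c : ℝ≥0∞) :
    8 * (4 * c + 1) ^ (1 - 1 / p) ≤ upperConst p M c := by
  have h8 : (8 : ℝ≥0∞) ≤ ENNReal.ofReal
      ((2 + 1 / (1 - (2 : ℝ) ^ (-(1 / p)))) * (2 : ℝ) ^ (2 - 1 / p)) := by
    simpa using ENNReal.ofReal_le_ofReal (eight_le_upperConst_factor hp)
  have h1 : (1 : ℝ≥0∞) ≤ (1 + M ^ p) ^ (1 / p) :=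
    ENNReal.one_le_rpow le_self_add (by positivity)
  rw [upperConst]
  gcongr
  exact h8.trans (le_mul_of_one_le_right' h1)

theorem eight_mul_rpow_le_rpow {p : ℝ} (hp : 1 < p) (L : ℝ≥0∞) :
    8 * L ^ (p - 1) ≤ (8 * L ^ (1 - 1 / p)) ^ p := by
  have hp0 : 0 < p := by linarith
  rw [ENNReal.mul_rpow_of_nonneg _ _ hp0.le, ← ENNReal.rpow_mul, sub_mul, one_mul,
    div_mul_cancel₀ _ hp0.ne']
  gcongr
  conv_lhs => rw [← ENNReal.rpow_one 8]
  exact ENNReal.rpow_le_rpow_of_exponent_le (by norm_num) hp.le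

end Constant

theorem theorem3 {Ω : Type u} {mΩ : MeasurableSpace Ω} (μ : Measure Ω) [IsProbabilityMeasure μ]
    (ℱ : Filtration ℕ mΩ) (hℱ : IsFilteredProbabilitySpace μ ℱ)
    (star : ℕ → Set Ω → Set Ω) (hstar : IsLargestChild μ ℱ star)
    (p : ℝ) (hp1 : 1 < p) (hp2 : p ≤ 2)
    (hE : carlesonConst μ (unstarredAtoms ℱ star) < ∞) :
    upperConst p (martingaleTypeConst.{u, 0} p ℝ)
        (carlesonConst μ (unstarredAtoms ℱ star)) < ∞ ∧
      ∀ (X : Type v) [NormedAddCommGroup X] [NormedSpace ℝ X] [CompleteSpace X] (f : Ω → X),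
        MemLp f (ENNReal.ofReal p) μ →
          eLpNorm f (ENNReal.ofReal p) μ ≤
            upperConst p (martingaleTypeConst.{u, 0} p ℝ)
              (carlesonConst μ (unstarredAtoms ℱ star)) * martingaleDiffNorm μ ℱ p f := by
  have hp0 : 0 < p := by linarith
  have hpe : 1 ≤ ENNReal.ofReal p := by
    simpa using ENNReal.ofReal_le_ofReal hp1.le
  refine ⟨upperConst_lt_top hp1 (martingaleTypeConst_real_lt_top hp1 hp2) hE, ?_⟩
  intro X _ _ _ f hf
  have hfi : Integrable f μ := hf.integrable hpe
  refine (eLpNorm_le_mul_martingaleDiffNorm hℱ hp0 hfi fun N => ?_).trans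
    (mul_le_mul_left (mul_rpow_le_upperConst hp1 _ _) _)
  exact (lintegral_condExp_rpow_le hℱ hstar hp1 hp2 hE hfi N).trans
    (mul_le_mul_left (eight_mul_rpow_le_rpow hp1 _) _)
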